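/- Setting. Let $P=(p_{ij})$ be the transition matrix of a $K$-state Markov chain (the channel of one user), let $(p^s_k)_{k}$ be its steady-state distribution, and put $\vec\pi_j^\tau=\vec e_jP^\tau$ for $j\in\{1,\dots,K\}$, $\tau\ge1$. The belief states are the pairs $(j,\tau)$, written $\vec\pi_j^\tau$. Consider the following single-arm Markov decision process on them. Under the passive action ($a=0$) the state $\vec\pi_j^\tau$ moves to $\vec\pi_j^{\tau+1}$ and the reward is $R(\vec\pi_j^\tau,0)+W$, where $W\in\mathbb R$ is the subsidy for passivity; under the active action ($a=1$) the next state is $\vec\pi_k^1$ with probability $p_k^s$, and the reward is the constant $R^1$. Assume $R^1\ge R(\vec\pi_j^\tau,0)\ge R(\vec\pi_j^{\tau'},0)$ for all $j$ and all $\tau'\ge\tau\ge1$. The average-reward optimality equation is $$V(\vec\pi_j^\tau)+g=\max\Big\{R(\vec\pi_j^\tau,0)+W+V(\vec\pi_j^{\tau+1}),\ R^1+\sum_{k=1}^Kp_k^sV(\vec\pi_k^1)\Big\},$$ with $g$ the optimal long-run expected average reward (from every initial state) and $V$ bounded. Whittle's index $W(\vec\pi_j^\tau)$ is the smallest $W$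 for which both actions are optimal in $\vec\pi_j^\tau$, that is, for which this equation has a solution such that the two terms of the maximum are equal at $\vec\pi_j^\tau$; it is $+\infty$ if there is no such $W$. Write $\omega_k=p_k^s$. Let $\vec\Gamma^{-1}=\vec 0$ and, for $i\ge0$, let $u^i$ be any element of $\operatorname{argmax}_{u\in\{1,\dots,K\}}R(\vec\pi_u^{\Gamma_u^{i-1}+1},0)$ and $\Gamma^i_k=\#\{r\in\{0,\dots,i\}:u^r=k\}$ for all $k$. Statement. (1) For every $j\ge0$, Whittle's index of $\vec\pi_{u^j}^{\Gamma^j_{u^j}}$ exists, is finite, and equals $$W\big(\vec\pi_{u^j}^{\Gamma^j_{u^j}}\big)=R^1+\sum_{k=1}^K\sum_{r=1}^{\Gamma_k^{j-1}}R(\vec\pi_k^r,0)\,\omega_k-R\big(\vec\pi_{u^j}^{\Gamma^j_{u^j}},0\big)\sum_{k=1}^K(\Gamma_k^{j-1}+1)\,\omega_k .$$ (2) For every $k$, $W(\vec\pi_k^\tau)$ is non-decreasing in $\tau$. (3) For $\vec\Gamma\in\{0,1,2,\dots\}^K$, the threshold policy $\vec\Gamma$ (active in $\vec\pi_j^\tau$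 if and only if $\tau>\Gamma_j$) has exactly one steady-state law $\alpha^{\vec\Gamma}$. Let $E(\vec\Gamma)$ be its mean steady-state reward for $W=0$, let $D(\vec\Gamma)=\sum_k\sum_{r=1}^{\Gamma_k}\alpha^{\vec\Gamma}(\vec\pi_k^r)$, and for $\vec\Gamma'>\vec\Gamma$ (that is, $\Gamma'_k\ge\Gamma_k$ for all $k$ and $\vec\Gamma'\ne\vec\Gamma$) put $\rho(\vec\Gamma,\vec\Gamma')=\frac{E(\vec\Gamma)-E(\vec\Gamma')}{D(\vec\Gamma')-D(\vec\Gamma)}$. Assume that $p_k^s>0$ for all $k$. If $\vec\Gamma'$ minimizes $\rho(\vec\Gamma,\cdot)$ over all vectors greater than $\vec\Gamma$, and $\sum_k\Gamma'_k=\sum_k\Gamma_k+1$, then, with $u$ the index such that $\Gamma'_u=\Gamma_u+1$, $$\inf_{\vec\Gamma''>\vec\Gamma}\rho(\vec\Gamma,\vec\Gamma'')=R^1+\sum_{k=1}^K\sum_{r=1}^{\Gamma_k}R(\vec\pi_k^r,0)\,\omega_k-R(\vec\pi_u^{\Gamma'_u},0)\sum_{k=1}^K(\Gamma_k+1)\,\omega_k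 .$$ Moreover, for every $j\ge0$ the vector $\vec\Gamma^j$ is a minimizer of $\rho(\vec\Gamma^{j-1},\cdot)$ over all vectors greater than $\vec\Gamma^{j-1}$, and the minimum is the value displayed in (1). -/

import Mathlib

open Filter

noncomputable section

/-- A single arm (user): a `K`-state channel with transition matrix `P`, a steady-state law `ps`
of that channel, the average immediate reward `R1` under the active action and the average
immediate reward `R0 b` under the passive action when the belief vector is `b`. -/
structure SingleArm (K : ℕ) where
  P : Matrix (Fin K) (Fin K) ℝ
  P_stochastic : P ∈ Matrix.rowStochastic ℝ (Fin K)
  ps : Fin K → ℝ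
  ps_nonneg : ∀ k, 0 ≤ ps k
  ps_sum : ∑ k, ps k = 1
  ps_stationary : Matrix.vecMul ps P = ps
  R1 : ℝ
  R0 : (Fin K → ℝ) → ℝ

/-- The state `(j, τ)`, with `τ ≥ 1`: the channel was last observed `τ` slots ago, in state `j`. -/
abbrev BState (K : ℕ) : Type := Fin K × ℕ+

namespace SingleArm

variable {K : ℕ}

/-- The belief vector `e_j P ^ τ`. -/
def belief (A : SingleArm K) (j : Fin K) (τ : ℕ) : Fin K → ℝ :=
  Matrix.vecMul (Pi.single j 1) (A.P ^ τ)

/-- The average passive reward `R(π_j^τ, 0)`; only `τ ≥ 1` is ever used. -/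
def passiveReward (A : SingleArm K) (j : Fin K) (τ : ℕ) : ℝ := A.R0 (A.belief j τ)

/-- Outdated information is worth less:
`R¹ ≥ R(π_j^τ, 0) ≥ R(π_j^τ', 0)` for all `τ' ≥ τ ≥ 1`. -/
def RewardMonotone (A : SingleArm K) : Prop :=
  ∀ (j : Fin K) (τ τ' : ℕ), 1 ≤ τ → τ ≤ τ' →
    A.passiveReward j τ ≤ A.R1 ∧ A.passiveReward j τ' ≤ A.passiveReward j τ

/-- Transition probabilities of the approximate model. Action `true` is active (the next state is
`(k, 1)` with probability `ps k`), action `false` is passive (`(j, τ)` moves to `(j, τ + 1)`). -/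
def q (A : SingleArm K) (a : Bool) (s s' : BState K) : ℝ :=
  if a then (if s'.2 = 1 then A.ps s'.1 else 0)
  else (if s' = (s.1, s.2 + 1) then 1 else 0)

/-- Expectation of `f` at the next state. -/
def expNext (A : SingleArm K) (a : Bool) (f : BState K → ℝ) (s : BState K) : ℝ :=
  ∑' s', A.q a s s' * f s'

theorem expNext_passive (A : SingleArm K) (f : BState K → ℝ) (s : BState K) :
    A.expNext false f s = f (s.1, s.2 + 1) := by
  unfold expNext
  rw [tsum_eq_single (s.1, s.2 + 1)]
  · simp [q]
  · intro s' h
    simp [q, h]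

theorem expNext_active (A : SingleArm K) (f : BState K → ℝ) (s : BState K) :
    A.expNext true f s = ∑ k, A.ps k * f (k, 1) := by
  unfold expNext
  rw [tsum_eq_sum (s := Finset.univ.image (fun k : Fin K => ((k, 1) : BState K)))]
  · rw [Finset.sum_image (by intro a _ b _ h; exact (Prod.mk.inj h).1)]
    simp [q]
  · rintro ⟨k, t⟩ h
    have ht : t ≠ 1 := by
      rintro rfl
      exact h (Finset.mem_image.2 ⟨k, Finset.mem_univ _, rfl⟩)
    simp [q, ht]

/-- Immediate reward with subsidy `W` for passivity. -/
def reward (A : SingleArm K) (W : ℝ) (a : Bool) (s : BState K) : ℝ :=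
  if a then A.R1 else A.passiveReward s.1 s.2 + W

/-- Expected reward in slot `t` (counted from `0`) under policy `φ`, started in `s`. -/
def expReward (A : SingleArm K) (W : ℝ) (φ : BState K → Bool) : ℕ → BState K → ℝ
  | 0, s => A.reward W (φ s) s
  | t + 1, s => A.expNext (φ s) (expReward A W φ t) s

/-- Long-run expected average reward of policy `φ`, started in `s`. It is an extended real number,
since the passive rewards need not be bounded below. -/
def avgReward (A : SingleArm K) (W : ℝ) (φ : BState K → Bool) (s : BState K) : EReal :=
  liminf (fun T : ℕ => (((∑ t ∈ Finset.range T, A.expReward W φ t s) / (T : ℝ) : ℝ) : EReal)) atTop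

/-- Optimal long-run expected average reward from `s`. -/
def optAvgReward (A : SingleArm K) (W : ℝ) (s : BState K) : EReal :=
  ⨆ φ : BState K → Bool, A.avgReward W φ s

/-- Right-hand side of the average-reward optimality equation, for the action `a`. -/
def actionValue (A : SingleArm K) (W : ℝ) (V : BState K → ℝ) (a : Bool) (s : BState K) : ℝ :=
  A.reward W a s + A.expNext a V s

/-- `(g, V)` solves the average-reward optimality equation with subsidy `W`: `g` is the optimal
average reward from every state, and `V` is a bounded relative value function. -/
def SolvesOptimality (A : SingleArm K) (W g : ℝ) (V : BState K → ℝ) : Prop :=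
  (∀ s, A.optAvgReward W s = (g : EReal)) ∧
  (∃ C : ℝ, ∀ s, |V s| ≤ C) ∧
  ∀ s, V s + g = max (A.actionValue W V false s) (A.actionValue W V true s)

/-- With subsidy `W`, both actions are optimal in state `s`. -/
def Indifferent (A : SingleArm K) (W : ℝ) (s : BState K) : Prop :=
  ∃ (g : ℝ) (V : BState K → ℝ), A.SolvesOptimality W g V ∧
    A.actionValue W V false s = A.actionValue W V true s

/-- Whittle's index: the smallest subsidy that makes both actions optimal in `s`
(`⊤` if there is none). -/
def whittleIndex (A : SingleArm K) (s : BState K) : EReal :=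
  sInf ((fun W : ℝ => (W : EReal)) '' {W | A.Indifferent W s})

/-- The threshold policy `Γ`: active in `(j, τ)` iff `τ > Γ j`. -/
def thresholdPolicy (Γ : Fin K → ℕ) (s : BState K) : Bool := decide (Γ s.1 < (s.2 : ℕ))

/-- `α` is a steady-state law of the chain that is driven by the threshold policy `Γ`. -/
def IsSteadyState (A : SingleArm K) (Γ : Fin K → ℕ) (α : BState K → ℝ) : Prop :=
  (∀ s, 0 ≤ α s) ∧ HasSum α 1 ∧
  ∀ s', HasSum (fun s => α s * A.q (thresholdPolicy Γ s) s s') (α s')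

/-- Mean steady-state reward (without subsidy) of the threshold policy `Γ`, for its steady-state
law `α`. -/
def meanReward (A : SingleArm K) (Γ : Fin K → ℕ) (α : BState K → ℝ) : ℝ :=
  ∑' s, α s * A.reward 0 (thresholdPolicy Γ s) s

/-- Steady-state probability `∑_k ∑_{r = 1}^{Γ_k} α(π_k^r)` of being passive. -/
def passiveProb (Γ : Fin K → ℕ) (α : BState K → ℝ) : ℝ :=
  ∑ k, ∑ r ∈ Finset.range (Γ k), α (k, r.succPNat)

/-- The subsidy at which the threshold policies `Γ` and `Γ'` have the same average reward. Here
`α Γ` is the steady-state law of the threshold policy `Γ`. -/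
def stepRatio (A : SingleArm K) (α : (Fin K → ℕ) → BState K → ℝ) (Γ Γ' : Fin K → ℕ) : ℝ :=
  (A.meanReward Γ (α Γ) - A.meanReward Γ' (α Γ')) /
    (passiveProb Γ' (α Γ') - passiveProb Γ (α Γ))

/-- The numbers whose infimum is the value `W_i` of the step that starts from the threshold vector
`Γ = Γ^{i-1}`. In the order of `Fin K → ℕ`, `Γ < Γ'` means `Γ ≤ Γ'` in every entry and `Γ ≠ Γ'`. -/
def stepValues (A : SingleArm K) (α : (Fin K → ℕ) → BState K → ℝ) (Γ : Fin K → ℕ) : Set ℝ :=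
  A.stepRatio α Γ '' {Γ' | Γ < Γ'}

/-- `R¹ + ∑_k ∑_{r = 1}^{Γ_k} R(π_k^r, 0) ω_k - R(π_v^τ, 0) ∑_k (Γ_k + 1) ω_k`, with
`ω_k = p_k^s`. -/
def closedForm (A : SingleArm K) (Γ : Fin K → ℕ) (v : Fin K) (τ : ℕ) : ℝ :=
  A.R1 + ∑ k, ∑ r ∈ Finset.Icc 1 (Γ k), A.passiveReward k r * A.ps k
    - A.passiveReward v τ * ∑ k, ((Γ k : ℝ) + 1) * A.ps k

/-- `countBefore u n k` is the number of `r < n` with `u r = k`. So `Γ^i = countBefore u (i + 1)`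
and `Γ^{i-1} = countBefore u i`, with `Γ^{-1} = 0`. -/
def countBefore (u : ℕ → Fin K) (n : ℕ) (k : Fin K) : ℕ :=
  ((Finset.range n).filter (fun r => u r = k)).card

/-- For every `i ≥ 0`, `u^i` is a maximizer of `v ↦ R(π_v^{Γ^{i-1}_v + 1}, 0)`
(any one of them, if there are several). -/
def IsGreedy (A : SingleArm K) (u : ℕ → Fin K) : Prop :=
  ∀ (i : ℕ) (v : Fin K), A.passiveReward v (countBefore u i v + 1) ≤
    A.passiveReward (u i) (countBefore u i (u i) + 1)

end SingleArm

end

/-! The active action has the same value in every state, so a passive stretch is a stopping problem: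
being passive pays `R - (g - W)` per slot relative to the average `g`. Passive rewards decrease
along a stretch, so it is optimal to stay passive exactly while they exceed the level `h = g - W`.
The relative value is then `excess h`, the sum of the positive parts of `R - h`. Consistency at the
active action gives `W = levelSubsidy h`.

Indifference at `s` forces `h` to be the passive reward of `s`: otherwise bounded relative values
would grow linearly along the passive path (`passiveReward_eq_of_indifferent`). Any bounded solution
dominates `excess h` up to a constant, so `levelSubsidy h` is the smallest such subsidy. It is
antitone in `h`, whence monotonicity in `τ`. Along the greedy sequence the rewards above the current
level are among those already collected (`IsGreedy.le_passiveReward`), so the excess is a finite sum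
and the closed form results.

For the steps, a threshold policy is a renewal process with mean cycle reward `S` and mean cycle
length `N`. Its mean reward is `S / N` and its passive probability is `1 - 1 / N`, so `ρ = S - N (S'
- S) / (N' - N)`. Minimizing `ρ` means maximizing the average added reward per added slot; by
monotonicity this is at most the best next passive reward, which a single greedy step attains. -/

namespace SingleArm

variable {K : ℕ}

/-! ### Verification of the average-reward optimality equation -/

section Optimality

theorem sum_expNext (A : SingleArm K) (a : Bool) (f : ℕ → BState K → ℝ) (T : ℕ)
    (s : BState K) :
    ∑ t ∈ Finset.range T, A.expNext a (f t) s =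
      A.expNext a (fun s' => ∑ t ∈ Finset.range T, f t s') s := by
  cases a
  · simp only [expNext_passive]
  · simp only [expNext_active, Finset.mul_sum]
    exact Finset.sum_comm

theorem expNext_mono (A : SingleArm K) (a : Bool) {f f' : BState K → ℝ} (h : ∀ s, f s ≤ f' s)
    (s : BState K) : A.expNext a f s ≤ A.expNext a f' s := by
  cases a
  · simpa only [expNext_passive] using h _
  · simp only [expNext_active]
    exact Finset.sum_le_sum fun k _ => mul_le_mul_of_nonneg_left (h _) (A.ps_nonneg k)

theorem expNext_add_const (A : SingleArm K) (a : Bool) (f : BState K → ℝ) (c : ℝ)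
    (s : BState K) : A.expNext a (fun s' => f s' + c) s = A.expNext a f s + c := by
  cases a
  · simp only [expNext_passive]
  · simp only [expNext_active, mul_add, Finset.sum_add_distrib, ← Finset.sum_mul, A.ps_sum,
      one_mul]

theorem sum_expReward_succ (A : SingleArm K) (W : ℝ) (φ : BState K → Bool) (T : ℕ)
    (s : BState K) :
    ∑ t ∈ Finset.range (T + 1), A.expReward W φ t s = A.reward W (φ s) s +
      A.expNext (φ s) (fun s' => ∑ t ∈ Finset.range T, A.expReward W φ t s') s := by
  rw [Finset.sum_range_succ', ← sum_expNext, add_comm]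
  rfl

/-- The bound has the form `V s` plus a constant so that the induction on the horizon closes by one
application of the optimality inequality; `C` only serves to absorb `V s` at horizon zero. -/
theorem sum_expReward_le (A : SingleArm K) {W g C : ℝ} {V : BState K → ℝ}
    (hC : ∀ s, |V s| ≤ C) (hV : ∀ a s, A.actionValue W V a s ≤ V s + g) (φ : BState K → Bool)
    (T : ℕ) : ∀ s, ∑ t ∈ Finset.range T, A.expReward W φ t s ≤ V s + (T * g + C) := by
  induction T with
  | zero =>
    intro s
    have := neg_le_of_abs_le (hC s)
    simp
    linarith
  | succ T ih =>
    intro s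
    rw [sum_expReward_succ]
    have h1 := A.expNext_mono (φ s) ih s
    rw [expNext_add_const] at h1
    have h2 := hV (φ s) s
    unfold actionValue at h2
    push_cast
    linarith

theorem le_sum_expReward (A : SingleArm K) {W g C : ℝ} {V : BState K → ℝ}
    (hC : ∀ s, |V s| ≤ C) {φ : BState K → Bool}
    (hV : ∀ s, V s + g ≤ A.actionValue W V (φ s) s) (T : ℕ) :
    ∀ s, V s + (T * g - C) ≤ ∑ t ∈ Finset.range T, A.expReward W φ t s := by
  induction T with
  | zero =>
    intro s
    have := le_of_abs_le (hC s)
    simp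
    linarith
  | succ T ih =>
    intro s
    rw [sum_expReward_succ]
    have h1 := A.expNext_mono (φ s) ih s
    rw [expNext_add_const] at h1
    have h2 := hV s
    unfold actionValue at h2
    push_cast
    linarith

theorem liminf_add_const_div (g c : ℝ) :
    liminf (fun T : ℕ => ((g + c / (T : ℝ) : ℝ) : EReal)) atTop = (g : EReal) := by
  refine Tendsto.liminf_eq ?_
  refine (continuous_coe_real_ereal.tendsto g).comp ?_
  simpa using (tendsto_const_div_atTop_nhds_zero_nat c).const_add g

/-- A bounded solution of the optimality equation certifies the optimal average reward. -/
theorem optAvgReward_eq (A : SingleArm K) {W g C : ℝ} {V : BState K → ℝ}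
    (hC : ∀ s, |V s| ≤ C)
    (hV : ∀ s, V s + g = max (A.actionValue W V false s) (A.actionValue W V true s))
    (s : BState K) : A.optAvgReward W s = (g : EReal) := by
  have hs := abs_le.1 (hC s)
  apply le_antisymm
  · refine iSup_le fun φ => ?_
    rw [← liminf_add_const_div g (2 * C)]
    refine liminf_le_liminf ?_
    filter_upwards [eventually_gt_atTop 0] with T hT
    have hT' : (0 : ℝ) < T := by exact_mod_cast hT
    rw [EReal.coe_le_coe_iff, div_le_iff₀ hT', add_mul, div_mul_cancel₀ _ hT'.ne']
    have := A.sum_expReward_le hC (g := g) (W := W) (fun a s => by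
      rw [hV s]
      cases a
      · exact le_max_left _ _
      · exact le_max_right _ _) φ T s
    linarith
  · classical
    have hφ : ∀ s, ∃ a : Bool, V s + g ≤ A.actionValue W V a s := by
      intro s
      rw [hV s]
      rcases max_choice (A.actionValue W V false s) (A.actionValue W V true s) with h | h
      · exact ⟨false, h.le⟩
      · exact ⟨true, h.le⟩
    choose φ hφ using hφ
    refine le_iSup_of_le φ ?_
    rw [← liminf_add_const_div g (-(2 * C))]
    refine liminf_le_liminf ?_
    filter_upwards [eventually_gt_atTop 0] with T hT
    have hT' : (0 : ℝ) < T := by exact_mod_cast hT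
    rw [EReal.coe_le_coe_iff, le_div_iff₀ hT', add_mul, div_mul_cancel₀ _ hT'.ne']
    have := A.le_sum_expReward hC hφ T s
    linarith

end Optimality

/-! ### The index as the subsidy attached to a reward level -/

section Index

/-- The total excess of the passive rewards over the level `h`, from state `s` on. -/
noncomputable def excess (A : SingleArm K) (h : ℝ) (s : BState K) : ℝ :=
  ∑' i : ℕ, max (A.passiveReward s.1 (s.2 + i) - h) 0

/-- The total excess over the level `h` is finite in every channel state. -/
def SummableExcess (A : SingleArm K) (h : ℝ) : Prop :=
  ∀ k, Summable fun i : ℕ => max (A.passiveReward k (1 + i) - h) 0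

/-- The subsidy for which the optimal average reward is `h` plus the subsidy. -/
noncomputable def levelSubsidy (A : SingleArm K) (h : ℝ) : ℝ :=
  A.R1 - h + ∑ k, A.ps k * A.excess h (k, 1)

theorem excess_nonneg (A : SingleArm K) (h : ℝ) (s : BState K) : 0 ≤ A.excess h s :=
  tsum_nonneg fun _ => le_max_right _ _

theorem SummableExcess.summable {A : SingleArm K} {h : ℝ} (hs : A.SummableExcess h)
    (s : BState K) : Summable fun i : ℕ => max (A.passiveReward s.1 (s.2 + i) - h) 0 := by
  have := (summable_nat_add_iff (PNat.natPred s.2)).2 (hs s.1)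
  refine this.congr fun i => ?_
  have h2 : 1 + (i + PNat.natPred s.2) = s.2 + i := by
    have := PNat.natPred_add_one s.2
    omega
  rw [h2]

theorem SummableExcess.excess_eq {A : SingleArm K} {h : ℝ} (hs : A.SummableExcess h)
    (s : BState K) : A.excess h s =
      max (A.passiveReward s.1 s.2 - h) 0 + A.excess h (s.1, s.2 + 1) := by
  unfold excess
  rw [(hs.summable s).tsum_eq_zero_add]
  congr 1
  refine tsum_congr fun i => ?_
  have h2 : (s.2 : ℕ) + (i + 1) = ((s.2 + 1 : ℕ+) : ℕ) + i := by
    rw [PNat.add_coe, PNat.one_coe]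
    omega
  rw [h2]

theorem RewardMonotone.excess_eq_zero {A : SingleArm K} (hR : A.RewardMonotone) {h : ℝ}
    {s : BState K} (hs : A.passiveReward s.1 s.2 ≤ h) : A.excess h s = 0 := by
  unfold excess
  refine (tsum_congr fun i => max_eq_right ?_).trans tsum_zero
  have := (hR s.1 s.2 (s.2 + i) s.2.pos (Nat.le_add_right _ _)).2
  linarith

theorem SummableExcess.excess_le {A : SingleArm K} {h : ℝ} (hs : A.SummableExcess h)
    (k : Fin K) (τ : ℕ+) : A.excess h (k, τ) ≤ A.excess h (k, 1) := by
  induction τ using PNat.recOn with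
  | one => exact le_rfl
  | succ τ ih =>
    have h1 := hs.excess_eq (k, τ)
    have h2 := le_max_right (A.passiveReward k τ - h) 0
    simp only at h1
    linarith

/-- The relative values are normalized so that the active action is worth exactly `g`; the equation
then reduces to the one-step recursion of the excess. Below the level all later terms vanish as
well, because rewards decrease. -/
theorem SummableExcess.solvesOptimality {A : SingleArm K} (hR : A.RewardMonotone) {h : ℝ}
    (hs : A.SummableExcess h) :
    A.SolvesOptimality (A.levelSubsidy h) (A.levelSubsidy h + h) (A.excess h) := by
  have hC : ∀ s, |A.excess h s| ≤ ∑ k, A.excess h (k, 1) := by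
    rintro ⟨k, τ⟩
    rw [abs_of_nonneg (A.excess_nonneg h _)]
    exact (hs.excess_le k τ).trans
      (Finset.single_le_sum (f := fun k => A.excess h (k, 1))
        (fun k _ => A.excess_nonneg h _) (Finset.mem_univ k))
  have hV : ∀ s, A.excess h s + (A.levelSubsidy h + h) =
      max (A.actionValue (A.levelSubsidy h) (A.excess h) false s)
        (A.actionValue (A.levelSubsidy h) (A.excess h) true s) := by
    intro s
    have h1 : A.actionValue (A.levelSubsidy h) (A.excess h) true s = A.levelSubsidy h + h := by
      simp only [actionValue, expNext_active, reward, levelSubsidy, if_true]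
      ring
    have h2 : A.actionValue (A.levelSubsidy h) (A.excess h) false s =
        (A.passiveReward s.1 s.2 - h + A.excess h (s.1, s.2 + 1)) + (A.levelSubsidy h + h) := by
      simp only [actionValue, expNext_passive, reward, Bool.false_eq_true, if_false]
      ring
    rw [h1, h2]
    -- Writing the active value as `0 + g` lets the common summand `g` leave the maximum.
    nth_rw 3 [← zero_add (A.levelSubsidy h + h)]
    rw [max_add_add_right]
    congr 1
    rcases le_total (A.passiveReward s.1 s.2) h with h3 | h3
    · have h4 := hR.excess_eq_zero h3
      have h5 := hs.excess_eq s
      rw [max_eq_right (by linarith)] at h5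
      rw [h4, max_eq_right (by linarith)]
    · have h5 := hs.excess_eq s
      rw [max_eq_left (by linarith)] at h5
      rw [← h5, max_eq_left (A.excess_nonneg h s)]
  exact ⟨A.optAvgReward_eq hC hV, ⟨_, hC⟩, hV⟩

theorem SummableExcess.indifferent {A : SingleArm K} (hR : A.RewardMonotone) {s : BState K}
    (hs : A.SummableExcess (A.passiveReward s.1 s.2)) :
    A.Indifferent (A.levelSubsidy (A.passiveReward s.1 s.2)) s := by
  refine ⟨_, _, hs.solvesOptimality hR, ?_⟩
  have h0 : A.excess (A.passiveReward s.1 s.2) (s.1, s.2 + 1) = 0 := by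
    refine hR.excess_eq_zero ?_
    exact (hR s.1 s.2 _ s.2.pos (by simp)).2
  simp only [actionValue, expNext_active, expNext_passive, reward, levelSubsidy, if_true,
    Bool.false_eq_true, if_false, h0]
  ring

/-- Indifference forces the optimal average reward, less the subsidy, to be the passive reward:
otherwise the relative values would grow linearly along the passive path. -/
theorem passiveReward_eq_of_indifferent {A : SingleArm K} (hR : A.RewardMonotone) {W g : ℝ}
    {V : BState K → ℝ} {s : BState K} (hV : A.SolvesOptimality W g V)
    (hs : A.actionValue W V false s = A.actionValue W V true s) :
    A.passiveReward s.1 s.2 = g - W := by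
  obtain ⟨-, ⟨C, hC⟩, hV⟩ := hV
  simp only [actionValue, expNext_active, expNext_passive, reward, if_true,
    Bool.false_eq_true, if_false] at hV hs
  set c := A.R1 + ∑ k, A.ps k * V (k, 1) with hc
  have h1 := hV s
  rw [hs, max_self] at h1
  by_contra hne
  -- At `s` the value is `c - g`, and everywhere it is at least `c - g`; comparing with the next
  -- state excludes a passive reward above `g - W`.
  have hlt : A.passiveReward s.1 s.2 < g - W := by
    have h2 := hV (s.1, s.2 + 1)
    have h3 := le_max_right (A.passiveReward (s.1, s.2 + 1).1 (s.1, s.2 + 1).2 + W +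
      V ((s.1, s.2 + 1).1, (s.1, s.2 + 1).2 + 1)) c
    rcases lt_or_gt_of_ne hne with h | h
    · exact h
    · linarith
  set a := g - W - A.passiveReward s.1 s.2 with ha
  have ha0 : 0 < a := by linarith
  -- Once the value lies strictly above `c - g`, the active term cannot attain the maximum, so the
  -- passive recursion holds and adds at least `a` in every slot, the later rewards being no larger.
  have key : ∀ n : ℕ, c - g + (n + 1) * a ≤ V (s.1, s.2 + n.succPNat) := by
    intro n
    induction n with
    | zero =>
      have : (Nat.succPNat 0) = 1 := rfl
      rw [this]
      push_cast
      linarith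
    | succ n ih =>
      have h2 := hV (s.1, s.2 + n.succPNat)
      have h3 : (s.2 + n.succPNat) + 1 = s.2 + (n + 1).succPNat := by
        apply PNat.eq
        simp only [PNat.add_coe, Nat.succPNat_coe, PNat.one_coe]
        omega
      simp only [h3] at h2
      have h4 := (hR s.1 s.2 ((s.2 + n.succPNat : ℕ+) : ℕ) s.2.pos (by simp)).2
      have h5 : 0 < ((n : ℝ) + 1) * a := by positivity
      rcases max_choice (A.passiveReward s.1 ((s.2 + n.succPNat : ℕ+) : ℕ) + W +
        V (s.1, s.2 + (n + 1).succPNat)) c with h6 | h6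
      · rw [h6] at h2
        push_cast at *
        linarith
      · rw [h6] at h2
        linarith
  obtain ⟨n, hn⟩ := exists_nat_gt ((C - (c - g)) / a)
  have h2 := key n
  have h3 := le_of_abs_le (hC (s.1, s.2 + n.succPNat))
  rw [div_lt_iff₀ ha0] at hn
  linarith

/-- Only an inequality is available for `W`: a bounded solution may exceed the excess by more than a
constant, but it always dominates it after subtraction of `c - g`. Boundedness on all states makes
the excess finite in every channel state, including those of probability zero. -/
theorem summableExcess_of_indifferent {A : SingleArm K} (hR : A.RewardMonotone) {W : ℝ}
    {s : BState K} (hs : A.Indifferent W s) :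
    A.SummableExcess (A.passiveReward s.1 s.2) ∧
      A.levelSubsidy (A.passiveReward s.1 s.2) ≤ W := by
  obtain ⟨g, V, hV, hs⟩ := hs
  have hh := passiveReward_eq_of_indifferent hR hV hs
  set h := A.passiveReward s.1 s.2
  obtain ⟨-, -, hV⟩ := hV
  simp only [actionValue, expNext_active, expNext_passive, reward, if_true,
    Bool.false_eq_true, if_false] at hV
  set c := A.R1 + ∑ k, A.ps k * V (k, 1) with hc
  -- While the reward is at least `h`, the passive term splits off the first summand; once it is at
  -- most `h`, every summand vanishes and the active term gives the bound.
  have hbd : ∀ (n : ℕ) (k : Fin K) (τ : ℕ+),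
      ∑ i ∈ Finset.range n, max (A.passiveReward k (τ + i) - h) 0 ≤ V (k, τ) - (c - g) := by
    intro n
    induction n with
    | zero =>
      intro k τ
      have h1 := hV (k, τ)
      have h2 := le_max_right (A.passiveReward k τ + W + V (k, τ + 1)) c
      simp only [Finset.range_zero, Finset.sum_empty]
      simp only at h1
      linarith
    | succ n ih =>
      intro k τ
      have h1 := hV (k, τ)
      simp only at h1
      rcases le_total h (A.passiveReward k τ) with h3 | h3
      · have h2 := le_max_left (A.passiveReward k τ + W + V (k, τ + 1)) c
        rw [Finset.sum_range_succ']
        have h4 := ih k (τ + 1)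
        have h5 : ∀ i : ℕ, ((τ + 1 : ℕ+) : ℕ) + i = τ + (i + 1) := by
          intro i
          rw [PNat.add_coe, PNat.one_coe]
          omega
        simp only [h5] at h4
        rw [add_zero, max_eq_left (by linarith : 0 ≤ A.passiveReward k τ - h)]
        linarith
      · have h2 := le_max_right (A.passiveReward k τ + W + V (k, τ + 1)) c
        rw [Finset.sum_eq_zero]
        · linarith
        · intro i _
          have := (hR k τ (τ + i) τ.pos (Nat.le_add_right _ _)).2
          exact max_eq_right (by linarith)
  have hsum : A.SummableExcess h := fun k =>
    summable_of_sum_range_le (fun _ => le_max_right _ _) (fun n => hbd n k 1)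
  refine ⟨hsum, ?_⟩
  have hle : ∀ k, A.excess h (k, 1) ≤ V (k, 1) - (c - g) := fun k =>
    Real.tsum_le_of_sum_range_le (fun _ => le_max_right _ _) (fun n => hbd n k 1)
  have : ∑ k, A.ps k * A.excess h (k, 1) ≤ ∑ k, A.ps k * (V (k, 1) - (c - g)) :=
    Finset.sum_le_sum fun k _ => mul_le_mul_of_nonneg_left (hle k) (A.ps_nonneg k)
  simp only [mul_sub, Finset.sum_sub_distrib, ← Finset.sum_mul, A.ps_sum] at this
  unfold levelSubsidy
  linarith

theorem SummableExcess.mono {A : SingleArm K} {h h' : ℝ} (hs : A.SummableExcess h)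
    (hh : h ≤ h') : A.SummableExcess h' := fun k =>
  (hs k).of_nonneg_of_le (fun _ => le_max_right _ _)
    (fun _ => max_le_max_right _ (by linarith))

theorem SummableExcess.levelSubsidy_le {A : SingleArm K} {h h' : ℝ} (hs : A.SummableExcess h)
    (hh : h ≤ h') : A.levelSubsidy h' ≤ A.levelSubsidy h := by
  have : ∑ k, A.ps k * A.excess h' (k, 1) ≤ ∑ k, A.ps k * A.excess h (k, 1) :=
    Finset.sum_le_sum fun k _ => mul_le_mul_of_nonneg_left
      (((hs.mono hh).summable _).tsum_le_tsum
        (fun _ => max_le_max_right _ (by linarith)) (hs.summable _)) (A.ps_nonneg k)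
  unfold levelSubsidy
  linarith

theorem SummableExcess.isLeast_indifferent {A : SingleArm K} (hR : A.RewardMonotone)
    {s : BState K} (hs : A.SummableExcess (A.passiveReward s.1 s.2)) :
    IsLeast {W : ℝ | A.Indifferent W s} (A.levelSubsidy (A.passiveReward s.1 s.2)) :=
  ⟨hs.indifferent hR, fun _ hW => (summableExcess_of_indifferent hR hW).2⟩

theorem whittleIndex_eq_of_isLeast {A : SingleArm K} {s : BState K} {W : ℝ}
    (hW : IsLeast {W : ℝ | A.Indifferent W s} W) : A.whittleIndex s = (W : EReal) :=
  (Monotone.map_isLeast (fun _ _ h => EReal.coe_le_coe_iff.2 h) hW).isGLB.sInf_eq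

theorem RewardMonotone.monotone_whittleIndex {A : SingleArm K} (hR : A.RewardMonotone)
    (k : Fin K) : Monotone fun τ : ℕ+ => A.whittleIndex (k, τ) := by
  intro τ τ' hτ
  -- Testing against each subsidy that gives indifference at `τ'` also covers an infinite index
  -- there.
  refine le_sInf ?_
  rintro _ ⟨W, hW, rfl⟩
  obtain ⟨hs, hle⟩ := summableExcess_of_indifferent hR hW
  have hh := (hR k τ τ' τ.pos (by exact_mod_cast hτ)).2
  have hleast := SummableExcess.isLeast_indifferent (s := (k, τ)) hR (hs.mono hh)
  refine (whittleIndex_eq_of_isLeast hleast).trans_le (EReal.coe_le_coe_iff.2 ?_)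
  exact (hs.levelSubsidy_le hh).trans hle

end Index

/-! ### The excess along the greedy sequence -/

section Greedy

theorem countBefore_succ (u : ℕ → Fin K) (n : ℕ) (k : Fin K) :
    countBefore u (n + 1) k = countBefore u n k + if u n = k then 1 else 0 := by
  unfold countBefore
  rw [Finset.range_add_one, Finset.filter_insert]
  split_ifs
  · rw [Finset.card_insert_of_notMem (by simp)]
  · rfl

theorem countBefore_succ_self (u : ℕ → Fin K) (n : ℕ) :
    countBefore u (n + 1) (u n) = countBefore u n (u n) + 1 := by
  simp [countBefore_succ]

/-- Every reward collected by the greedy sequence exceeds every reward that is still available. -/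
theorem IsGreedy.le_passiveReward {A : SingleArm K} (hR : A.RewardMonotone) {u : ℕ → Fin K}
    (hu : A.IsGreedy u) (j : ℕ) (k v : Fin K) (r : ℕ) (h1 : 1 ≤ r)
    (hr : r ≤ countBefore u j k) :
    A.passiveReward v (countBefore u j v + 1) ≤ A.passiveReward k r := by
  induction j with
  | zero =>
    simp [countBefore] at hr
    omega
  | succ j ih =>
    have hv : A.passiveReward v (countBefore u (j + 1) v + 1) ≤
        A.passiveReward v (countBefore u j v + 1) :=
      (hR v _ _ (by omega) (by rw [countBefore_succ]; omega)).2
    refine hv.trans ?_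
    by_cases hr' : r ≤ countBefore u j k
    · exact ih hr'
    · rw [countBefore_succ] at hr
      split_ifs at hr with huk
      · obtain rfl : r = countBefore u j k + 1 := by omega
        rw [← huk]
        exact hu j v
      · omega

theorem IsGreedy.hasSum_excess {A : SingleArm K} (hR : A.RewardMonotone) {u : ℕ → Fin K}
    (hu : A.IsGreedy u) (j : ℕ) (k : Fin K) :
    HasSum (fun i : ℕ =>
        max (A.passiveReward k (1 + i) - A.passiveReward (u j) (countBefore u j (u j) + 1)) 0)
      (∑ r ∈ Finset.Icc 1 (countBefore u j k),
        (A.passiveReward k r - A.passiveReward (u j) (countBefore u j (u j) + 1))) := by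
  have h1 : ∑ r ∈ Finset.Icc 1 (countBefore u j k),
      (A.passiveReward k r - A.passiveReward (u j) (countBefore u j (u j) + 1)) =
      ∑ i ∈ Finset.range (countBefore u j k),
        max (A.passiveReward k (1 + i) - A.passiveReward (u j) (countBefore u j (u j) + 1)) 0 := by
    rw [← Finset.Ico_add_one_right_eq_Icc, Finset.sum_Ico_eq_sum_range, Nat.add_sub_cancel]
    refine Finset.sum_congr rfl fun i hi => (max_eq_left ?_).symm
    have := hu.le_passiveReward hR j k (u j) (1 + i) (by omega)
      (by have := Finset.mem_range.1 hi; omega)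
    linarith
  rw [h1]
  refine hasSum_sum_of_ne_finset_zero fun i hi => max_eq_right ?_
  have h2 := hu j k
  rw [Finset.mem_range, not_lt] at hi
  have h3 := (hR k (countBefore u j k + 1) (1 + i) (by omega) (by omega)).2
  linarith

theorem IsGreedy.levelSubsidy_eq {A : SingleArm K} (hR : A.RewardMonotone) {u : ℕ → Fin K}
    (hu : A.IsGreedy u) (j : ℕ) :
    A.levelSubsidy (A.passiveReward (u j) (countBefore u j (u j) + 1)) =
      A.closedForm (countBefore u j) (u j) (countBefore u j (u j) + 1) := by
  set h := A.passiveReward (u j) (countBefore u j (u j) + 1) with hh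
  have h1 : ∀ k, A.excess h (k, 1) =
      ∑ r ∈ Finset.Icc 1 (countBefore u j k), (A.passiveReward k r - h) :=
    fun k => (hu.hasSum_excess hR j k).tsum_eq
  unfold levelSubsidy closedForm
  rw [← hh]
  simp only [h1, Finset.sum_sub_distrib, Finset.sum_const, Nat.card_Icc, Nat.add_sub_cancel,
    nsmul_eq_mul, mul_sub, add_mul, one_mul, Finset.sum_add_distrib, A.ps_sum, ← Finset.sum_mul,
    mul_add, mul_one]
  have h2 : ∑ k, A.ps k * ((countBefore u j k : ℝ) * h) =
      h * ∑ k, (countBefore u j k : ℝ) * A.ps k := by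
    rw [Finset.mul_sum]
    exact Finset.sum_congr rfl fun k _ => by ring
  have h3 : ∑ k, A.ps k * ∑ r ∈ Finset.Icc 1 (countBefore u j k), A.passiveReward k r =
      ∑ k, (∑ r ∈ Finset.Icc 1 (countBefore u j k), A.passiveReward k r) * A.ps k :=
    Finset.sum_congr rfl fun k _ => mul_comm _ _
  rw [h2, h3]
  ring

theorem IsGreedy.isLeast_indifferent {A : SingleArm K} (hR : A.RewardMonotone) {u : ℕ → Fin K}
    (hu : A.IsGreedy u) (j : ℕ) (τ : ℕ+) (hτ : (τ : ℕ) = countBefore u (j + 1) (u j)) :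
    IsLeast {W : ℝ | A.Indifferent W (u j, τ)}
      (A.closedForm (countBefore u j) (u j) τ) := by
  rw [countBefore_succ_self] at hτ
  have hs : A.SummableExcess (A.passiveReward (u j) (countBefore u j (u j) + 1)) :=
    fun k => (hu.hasSum_excess hR j k).summable
  rw [hτ, ← hu.levelSubsidy_eq hR j]
  have := SummableExcess.isLeast_indifferent (s := (u j, τ)) hR (by simpa only [hτ] using hs)
  simpa only [hτ] using this

end Greedy

/-! ### Steady-state laws of threshold policies -/

section SteadyState

theorem hasSum_of_finite_horizon (Γ : Fin K → ℕ) (f : Fin K → ℕ → ℝ) :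
    HasSum (fun s : BState K => if (s.2 : ℕ) ≤ Γ s.1 + 1 then f s.1 s.2 else 0)
      (∑ k, ∑ r ∈ Finset.range (Γ k + 1), f k (r + 1)) := by
  classical
  let e : (Σ _ : Fin K, ℕ) → BState K := fun x => (x.1, x.2.succPNat)
  have he : Function.Injective e := by
    rintro ⟨k, r⟩ ⟨k', r'⟩ h
    obtain ⟨h1, h2⟩ := Prod.mk.inj h
    dsimp only at h1 h2
    rw [h1, Nat.succPNat_injective h2]
  have hsum : ∑ k, ∑ r ∈ Finset.range (Γ k + 1), f k (r + 1) =
      ∑ s ∈ ((Finset.univ : Finset (Fin K)).sigma fun k => Finset.range (Γ k + 1)).image e,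
        if (s.2 : ℕ) ≤ Γ s.1 + 1 then f s.1 s.2 else 0 := by
    rw [Finset.sum_image he.injOn, Finset.sum_sigma]
    refine Finset.sum_congr rfl fun k _ => Finset.sum_congr rfl fun r hr => ?_
    rw [Finset.mem_range] at hr
    exact (if_pos (show r + 1 ≤ Γ k + 1 by omega)).symm
  rw [hsum]
  refine hasSum_sum_of_ne_finset_zero ?_
  rintro ⟨k, τ⟩ hs
  refine if_neg fun hle => hs ?_
  refine Finset.mem_image.2 ⟨⟨k, τ.natPred⟩, ?_, ?_⟩
  · have := PNat.natPred_add_one τ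
    simp only [Finset.mem_sigma, Finset.mem_univ, Finset.mem_range, true_and]
    simp only at hle
    omega
  · simp [e]

/-- Mean length of a cycle between two active slots under the threshold policy `Γ`. -/
noncomputable def cycleLength (A : SingleArm K) (Γ : Fin K → ℕ) : ℝ := ∑ k, ((Γ k : ℝ) + 1) * A.ps k

/-- Mean reward of a cycle between two active slots under the threshold policy `Γ`. -/
noncomputable def cycleReward (A : SingleArm K) (Γ : Fin K → ℕ) : ℝ :=
  A.R1 + ∑ k, ∑ r ∈ Finset.Icc 1 (Γ k), A.passiveReward k r * A.ps k

theorem cycleLength_eq (A : SingleArm K) (Γ : Fin K → ℕ) :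
    A.cycleLength Γ = 1 + ∑ k, (Γ k : ℝ) * A.ps k := by
  simp only [cycleLength, add_mul, one_mul, Finset.sum_add_distrib, A.ps_sum]
  ring

theorem cycleLength_pos (A : SingleArm K) (Γ : Fin K → ℕ) : 0 < A.cycleLength Γ := by
  rw [cycleLength_eq]
  have : 0 ≤ ∑ k, (Γ k : ℝ) * A.ps k :=
    Finset.sum_nonneg fun k _ => mul_nonneg (Nat.cast_nonneg _) (A.ps_nonneg k)
  linarith

/-- The steady-state law of the threshold policy `Γ`. -/
noncomputable def thresholdLaw (A : SingleArm K) (Γ : Fin K → ℕ) (s : BState K) : ℝ :=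
  if (s.2 : ℕ) ≤ Γ s.1 + 1 then A.ps s.1 / A.cycleLength Γ else 0

theorem hasSum_thresholdLaw_mul (A : SingleArm K) (Γ : Fin K → ℕ) (f : Fin K → ℕ → ℝ) :
    HasSum (fun s : BState K => A.thresholdLaw Γ s * f s.1 s.2)
      ((∑ k, ∑ r ∈ Finset.range (Γ k + 1), A.ps k * f k (r + 1)) / A.cycleLength Γ) := by
  convert hasSum_of_finite_horizon Γ (fun k r => A.ps k / A.cycleLength Γ * f k r) using 1
  · funext s
    simp only [thresholdLaw, ite_mul, zero_mul]
  · simp only [Finset.sum_div]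
    refine Finset.sum_congr rfl fun k _ => Finset.sum_congr rfl fun r _ => by ring

/-- The only possible predecessor of `(k, τ + 1)` is `(k, τ)`, and only under the passive action. -/
theorem flow_into_succ (A : SingleArm K) (Γ : Fin K → ℕ) (α : BState K → ℝ) (k : Fin K)
    (τ : ℕ+) :
    HasSum (fun s => α s * A.q (thresholdPolicy Γ s) s (k, τ + 1))
      (if (τ : ℕ) ≤ Γ k then α (k, τ) else 0) := by
  have h1 : (if (τ : ℕ) ≤ Γ k then α (k, τ) else 0) =
      α (k, τ) * A.q (thresholdPolicy Γ (k, τ)) (k, τ) (k, τ + 1) := by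
    have h2 : (τ + 1 : ℕ+) ≠ 1 := (PNat.lt_add_left 1 τ).ne'
    by_cases h : (τ : ℕ) ≤ Γ k
    · simp [q, thresholdPolicy, h, not_lt.2 h]
    · simp only [q, thresholdPolicy, h, not_le.1 h, h2, decide_true, if_true, if_false, mul_zero]
  rw [h1]
  refine hasSum_single (k, τ) ?_
  rintro ⟨k', τ'⟩ hne
  have h2 : (τ + 1 : ℕ+) ≠ 1 := (PNat.lt_add_left 1 τ).ne'
  have h3 : ¬ ((k, τ + 1) = ((k', τ' + 1) : BState K)) := by
    intro h
    obtain ⟨h4, h5⟩ := Prod.mk.inj h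
    exact hne (by rw [h4, add_right_cancel h5])
  simp only [q, h2, h3, if_false, ite_self, mul_zero]

theorem q_into_one (A : SingleArm K) (a : Bool) (s : BState K) (k : Fin K) :
    A.q a s (k, 1) = if a then A.ps k else 0 := by
  have h2 : ¬ ((k, 1) = ((s.1, s.2 + 1) : BState K)) := by
    intro h
    exact (PNat.lt_add_left 1 s.2).ne (Prod.mk.inj h).2
  simp [q, h2]

theorem isSteadyState_thresholdLaw (A : SingleArm K) (Γ : Fin K → ℕ) :
    A.IsSteadyState Γ (A.thresholdLaw Γ) := by
  have hN := A.cycleLength_pos Γ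
  refine ⟨fun s => ?_, ?_, ?_⟩
  · unfold thresholdLaw
    split_ifs
    · exact div_nonneg (A.ps_nonneg _) hN.le
    · exact le_rfl
  · convert A.hasSum_thresholdLaw_mul Γ (fun _ _ => 1) using 1
    · simp
    · rw [eq_comm, div_eq_one_iff_eq hN.ne']
      simp [cycleLength]
  · rintro ⟨k, τ⟩
    induction τ using PNat.recOn with
    | one =>
      convert A.hasSum_thresholdLaw_mul Γ
        (fun k' r => if Γ k' < r then A.ps k else 0) using 1
      · funext s
        simp [q_into_one, thresholdPolicy]
      · have h1 : ∀ k' : Fin K, ∑ r ∈ Finset.range (Γ k' + 1),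
            A.ps k' * (if Γ k' < r + 1 then A.ps k else 0) = A.ps k' * A.ps k := by
          intro k'
          rw [Finset.sum_range_succ, Finset.sum_eq_zero, zero_add, if_pos (Nat.lt_succ_self _)]
          intro r hr
          rw [if_neg (by have := Finset.mem_range.1 hr; omega), mul_zero]
        simp only [h1, ← Finset.sum_mul, A.ps_sum, one_mul]
        simp [thresholdLaw]
    | succ τ _ =>
      convert A.flow_into_succ Γ (A.thresholdLaw Γ) k τ using 1
      simp only [thresholdLaw, PNat.add_coe, PNat.one_coe, add_le_add_iff_right]
      split_ifs <;> first | rfl | omega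

/-- The total active mass `p` determines the law: it fixes the mass at each `(k, 1)`, which is
carried unchanged along the passive path up to `Γ k + 1`, the active slot. Normalization then gives
`p` as the inverse of the cycle length. -/
theorem IsSteadyState.eq_thresholdLaw {A : SingleArm K} {Γ : Fin K → ℕ} {α : BState K → ℝ}
    (hα : A.IsSteadyState Γ α) : α = A.thresholdLaw Γ := by
  obtain ⟨h0, h1, hflow⟩ := hα
  have hN := A.cycleLength_pos Γ
  have hsum : Summable fun s => if thresholdPolicy Γ s then α s else 0 := by
    refine h1.summable.of_nonneg_of_le (fun s => ?_) (fun s => ?_)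
    · split_ifs
      · exact h0 s
      · exact le_rfl
    · split_ifs
      · exact le_rfl
      · exact h0 s
  set p := ∑' s, if thresholdPolicy Γ s then α s else 0 with hp
  have hone : ∀ k, α (k, 1) = p * A.ps k := by
    intro k
    refine (hflow (k, 1)).unique ?_
    have heq : (fun s => α s * A.q (thresholdPolicy Γ s) s (k, 1)) =
        fun s => (if thresholdPolicy Γ s then α s else 0) * A.ps k := by
      funext s
      rw [q_into_one]
      split_ifs <;> simp
    rw [heq]
    exact hsum.hasSum.mul_right (A.ps k)
  have hall : ∀ k (τ : ℕ+), α (k, τ) = if (τ : ℕ) ≤ Γ k + 1 then p * A.ps k else 0 := by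
    intro k τ
    induction τ using PNat.recOn with
    | one => simp [hone]
    | succ τ ih =>
      rw [(hflow (k, τ + 1)).unique (A.flow_into_succ Γ α k τ), ih]
      simp only [PNat.add_coe, PNat.one_coe, add_le_add_iff_right]
      split_ifs <;> first | rfl | omega
  have hpN : p * A.cycleLength Γ = 1 := by
    refine HasSum.unique ?_ h1
    convert hasSum_of_finite_horizon Γ (fun k _ => p * A.ps k) using 1
    · funext s
      exact hall s.1 s.2
    · simp only [cycleLength, Finset.mul_sum, Finset.sum_const, Finset.card_range, nsmul_eq_mul]
      exact Finset.sum_congr rfl fun k _ => by push_cast; ring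
  funext s
  rw [thresholdLaw, show α s = _ from hall s.1 s.2, eq_div_of_mul_eq hN.ne' hpN,
    one_div_mul_eq_div]

theorem existsUnique_isSteadyState (A : SingleArm K) (Γ : Fin K → ℕ) :
    ∃! α : BState K → ℝ, A.IsSteadyState Γ α :=
  ⟨_, A.isSteadyState_thresholdLaw Γ, fun _ hα => hα.eq_thresholdLaw⟩

theorem sum_Icc_one_eq_sum_range (f : ℕ → ℝ) (n : ℕ) :
    ∑ r ∈ Finset.Icc 1 n, f r = ∑ r ∈ Finset.range n, f (r + 1) := by
  rw [← Finset.Ico_add_one_right_eq_Icc, Finset.sum_Ico_eq_sum_range, Nat.add_sub_cancel]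
  exact Finset.sum_congr rfl fun i _ => by rw [add_comm]

theorem meanReward_thresholdLaw (A : SingleArm K) (Γ : Fin K → ℕ) :
    A.meanReward Γ (A.thresholdLaw Γ) = A.cycleReward Γ / A.cycleLength Γ := by
  have h := A.hasSum_thresholdLaw_mul Γ
    (fun k r => if Γ k < r then A.R1 else A.passiveReward k r)
  have h1 : ∀ k : Fin K, ∑ r ∈ Finset.range (Γ k + 1),
      A.ps k * (if Γ k < r + 1 then A.R1 else A.passiveReward k (r + 1)) =
      (∑ r ∈ Finset.Icc 1 (Γ k), A.passiveReward k r * A.ps k) + A.ps k * A.R1 := by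
    intro k
    rw [Finset.sum_range_succ, if_pos (Nat.lt_succ_self _), sum_Icc_one_eq_sum_range]
    congr 1
    refine Finset.sum_congr rfl fun r hr => ?_
    rw [if_neg (by have := Finset.mem_range.1 hr; omega), mul_comm]
  simp only [h1, Finset.sum_add_distrib, ← Finset.sum_mul, A.ps_sum, one_mul] at h
  unfold meanReward cycleReward
  simp only [Finset.sum_mul] at h
  rw [add_comm A.R1, ← h.tsum_eq]
  simp [reward, thresholdPolicy]

theorem passiveProb_thresholdLaw (A : SingleArm K) (Γ : Fin K → ℕ) :
    passiveProb Γ (A.thresholdLaw Γ) = 1 - 1 / A.cycleLength Γ := by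
  have hN := A.cycleLength_pos Γ
  have h1 : ∀ k : Fin K, ∑ r ∈ Finset.range (Γ k), A.thresholdLaw Γ (k, r.succPNat) =
      (Γ k : ℝ) * A.ps k / A.cycleLength Γ := by
    intro k
    rw [Finset.sum_congr rfl (g := fun _ => A.ps k / A.cycleLength Γ)]
    · simp only [Finset.sum_const, Finset.card_range, nsmul_eq_mul]
      ring
    · intro r hr
      have := Finset.mem_range.1 hr
      unfold thresholdLaw
      rw [if_pos (by simp only [Nat.succPNat_coe]; omega)]
  unfold passiveProb
  simp only [h1]
  rw [← Finset.sum_div, eq_sub_iff_add_eq, ← add_div, div_eq_one_iff_eq hN.ne', cycleLength_eq]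
  ring

end SteadyState

/-! ### Minimizing the step ratio -/

section StepValues

theorem stepRatio_eq (A : SingleArm K) {α : (Fin K → ℕ) → BState K → ℝ}
    (hα : ∀ Γ, A.IsSteadyState Γ (α Γ)) {Γ Γ' : Fin K → ℕ}
    (hlt : A.cycleLength Γ < A.cycleLength Γ') :
    A.stepRatio α Γ Γ' = A.cycleReward Γ - A.cycleLength Γ *
      ((A.cycleReward Γ' - A.cycleReward Γ) / (A.cycleLength Γ' - A.cycleLength Γ)) := by
  have hN := A.cycleLength_pos Γ
  have hN' := A.cycleLength_pos Γ'
  have hd : A.cycleLength Γ' - A.cycleLength Γ ≠ 0 := by linarith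
  unfold stepRatio
  rw [(hα Γ).eq_thresholdLaw, (hα Γ').eq_thresholdLaw, meanReward_thresholdLaw,
    meanReward_thresholdLaw, passiveProb_thresholdLaw, passiveProb_thresholdLaw]
  have h1 : 1 - 1 / A.cycleLength Γ' - (1 - 1 / A.cycleLength Γ) =
      (A.cycleLength Γ' - A.cycleLength Γ) / (A.cycleLength Γ * A.cycleLength Γ') := by
    field_simp
    ring
  rw [h1]
  field_simp
  ring

/-- Positivity of every `ps k` makes each larger threshold vector lengthen the cycle strictly, which
keeps the denominators of the step ratios positive. -/
theorem cycleLength_strictMono (A : SingleArm K) (hps : ∀ k, 0 < A.ps k) :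
    StrictMono A.cycleLength := by
  intro Γ Γ' h
  obtain ⟨hle, k, hk⟩ := Pi.lt_def.1 h
  refine Finset.sum_lt_sum (fun i _ => ?_) ⟨k, Finset.mem_univ k, ?_⟩
  · refine mul_le_mul_of_nonneg_right ?_ (A.ps_nonneg i)
    have : (Γ i : ℝ) ≤ Γ' i := by exact_mod_cast hle i
    linarith
  · refine mul_lt_mul_of_pos_right ?_ (hps k)
    have : (Γ k : ℝ) < Γ' k := by exact_mod_cast hk
    linarith

theorem stepRatio_add_single (A : SingleArm K) (hps : ∀ k, 0 < A.ps k)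
    {α : (Fin K → ℕ) → BState K → ℝ} (hα : ∀ Γ, A.IsSteadyState Γ (α Γ)) {Γ Γ' : Fin K → ℕ}
    {v : Fin K} (hv : Γ' v = Γ v + 1) (hne : ∀ k, k ≠ v → Γ' k = Γ k) :
    A.stepRatio α Γ Γ' = A.closedForm Γ v (Γ' v) := by
  have hL : A.cycleLength Γ' - A.cycleLength Γ = A.ps v := by
    unfold cycleLength
    rw [← Finset.sum_sub_distrib, Finset.sum_eq_single v]
    · rw [hv]
      push_cast
      ring
    · intro k _ hk
      rw [hne k hk, sub_self]
    · simp
  have hS : A.cycleReward Γ' - A.cycleReward Γ = A.passiveReward v (Γ' v) * A.ps v := by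
    unfold cycleReward
    rw [add_sub_add_left_eq_sub, ← Finset.sum_sub_distrib, Finset.sum_eq_single v]
    · rw [hv, Finset.sum_Icc_succ_top (by omega)]
      ring
    · intro k _ hk
      rw [hne k hk, sub_self]
    · simp
  have hp := hps v
  rw [A.stepRatio_eq hα (by linarith), hL, hS, mul_div_cancel_right₀ _ hp.ne']
  unfold closedForm cycleReward cycleLength
  ring

/-- The rewards added by raising the thresholds are at most the best available one. -/
theorem RewardMonotone.cycleReward_sub_le {A : SingleArm K} (hR : A.RewardMonotone)
    {Γ Γ' : Fin K → ℕ} (hle : Γ ≤ Γ') {h : ℝ} (hh : ∀ v, A.passiveReward v (Γ v + 1) ≤ h) :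
    A.cycleReward Γ' - A.cycleReward Γ ≤ h * (A.cycleLength Γ' - A.cycleLength Γ) := by
  unfold cycleReward cycleLength
  rw [add_sub_add_left_eq_sub, ← Finset.sum_sub_distrib, ← Finset.sum_sub_distrib,
    Finset.mul_sum]
  refine Finset.sum_le_sum fun k _ => ?_
  have key : ∀ n, Γ k ≤ n → ∑ r ∈ Finset.Icc 1 n, A.passiveReward k r * A.ps k -
      ∑ r ∈ Finset.Icc 1 (Γ k), A.passiveReward k r * A.ps k ≤
      h * (((n : ℝ) + 1) * A.ps k - ((Γ k : ℝ) + 1) * A.ps k) := by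
    intro n hn
    induction n, hn using Nat.le_induction with
    | base => simp
    | succ n hn ih =>
      rw [Finset.sum_Icc_succ_top (by omega)]
      have h1 := (hR k (Γ k + 1) (n + 1) (by omega) (by omega)).2
      have h2 := mul_le_mul_of_nonneg_right (h1.trans (hh k)) (A.ps_nonneg k)
      push_cast
      linarith
  exact key _ (hle k)

theorem countBefore_lt_succ (u : ℕ → Fin K) (j : ℕ) :
    countBefore u j < countBefore u (j + 1) := by
  refine Pi.lt_def.2 ⟨fun k => ?_, u j, ?_⟩
  · rw [countBefore_succ]
    exact Nat.le_add_right _ _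
  · rw [countBefore_succ_self]
    exact Nat.lt_succ_self _

theorem stepRatio_countBefore {A : SingleArm K} (hps : ∀ k, 0 < A.ps k)
    {α : (Fin K → ℕ) → BState K → ℝ} (hα : ∀ Γ, A.IsSteadyState Γ (α Γ)) (u : ℕ → Fin K)
    (j : ℕ) : A.stepRatio α (countBefore u j) (countBefore u (j + 1)) =
      A.closedForm (countBefore u j) (u j) (countBefore u (j + 1) (u j)) :=
  A.stepRatio_add_single hps hα (countBefore_succ_self u j) fun k hk => by
    rw [countBefore_succ, if_neg hk.symm, add_zero]

theorem IsGreedy.isLeast_stepValues {A : SingleArm K} (hR : A.RewardMonotone) {u : ℕ → Fin K}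
    (hu : A.IsGreedy u) (hps : ∀ k, 0 < A.ps k) {α : (Fin K → ℕ) → BState K → ℝ}
    (hα : ∀ Γ, A.IsSteadyState Γ (α Γ)) (j : ℕ) :
    IsLeast (A.stepValues α (countBefore u j))
      (A.closedForm (countBefore u j) (u j) (countBefore u (j + 1) (u j))) := by
  refine ⟨⟨countBefore u (j + 1), countBefore_lt_succ u j, stepRatio_countBefore hps hα u j⟩, ?_⟩
  rintro _ ⟨Γ', hlt, rfl⟩
  have hL := A.cycleLength_strictMono hps hlt
  -- The greedy choice makes the next reward of `u j` an upper bound for every next reward, hence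
  -- for the average reward of any added slots.
  have h1 := hR.cycleReward_sub_le (le_of_lt hlt) (hu j)
  rw [← div_le_iff₀ (by linarith)] at h1
  have h2 := mul_le_mul_of_nonneg_left h1 (A.cycleLength_pos (countBefore u j)).le
  rw [A.stepRatio_eq hα hL, countBefore_succ_self]
  -- The closed form is by definition `S - h N`, which matches the shape of `stepRatio_eq`.
  change A.cycleReward (countBefore u j) - A.passiveReward (u j) (countBefore u j (u j) + 1) *
    A.cycleLength (countBefore u j) ≤ _
  linarith

theorem eq_of_sum_eq_add_one {Γ Γ' : Fin K → ℕ} (hle : Γ ≤ Γ')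
    (hsum : ∑ k, Γ' k = (∑ k, Γ k) + 1) {v : Fin K} (hv : Γ' v = Γ v + 1) (k : Fin K)
    (hk : k ≠ v) : Γ' k = Γ k := by
  have h1 := Finset.add_sum_erase Finset.univ Γ (Finset.mem_univ v)
  have h2 := Finset.add_sum_erase Finset.univ Γ' (Finset.mem_univ v)
  have h3 : ∑ i ∈ Finset.univ.erase v, Γ i = ∑ i ∈ Finset.univ.erase v, Γ' i := by omega
  exact ((Finset.sum_eq_sum_iff_of_le fun i _ => hle i).1 h3 k
    (Finset.mem_erase.2 ⟨hk, Finset.mem_univ k⟩)).symm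

end StepValues

end SingleArm

theorem corollary1 {K : ℕ} (A : SingleArm K) (hR : A.RewardMonotone)
    (u : ℕ → Fin K) (hu : A.IsGreedy u) :
    -- the closed form of Whittle's index along the greedy sequence
    (∀ (j : ℕ) (τ : ℕ+), (τ : ℕ) = SingleArm.countBefore u (j + 1) (u j) →
      IsLeast {W : ℝ | A.Indifferent W (u j, τ)}
        (A.closedForm (SingleArm.countBefore u j) (u j) τ) ∧
      A.whittleIndex (u j, τ) =
        ((A.closedForm (SingleArm.countBefore u j) (u j) τ : ℝ) : EReal)) ∧
    -- Whittle's index is non-decreasing in `τ`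
    (∀ k : Fin K, Monotone (fun τ : ℕ+ => A.whittleIndex (k, τ))) ∧
    -- every threshold policy has exactly one steady-state law
    (∀ Γ : Fin K → ℕ, ∃! α : BState K → ℝ, A.IsSteadyState Γ α) ∧
    -- the values `W_i` of the steps that compute the index
    ((∀ k, 0 < A.ps k) →
      ∀ α : (Fin K → ℕ) → BState K → ℝ, (∀ Γ, A.IsSteadyState Γ (α Γ)) →
        (∀ Γ Γ' : Fin K → ℕ, Γ < Γ' → ∑ k, Γ' k = (∑ k, Γ k) + 1 →
          IsLeast (A.stepValues α Γ) (A.stepRatio α Γ Γ') →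
          ∀ v : Fin K, Γ' v = Γ v + 1 →
            IsLeast (A.stepValues α Γ) (A.closedForm Γ v (Γ' v))) ∧
        (∀ j : ℕ,
          A.stepRatio α (SingleArm.countBefore u j) (SingleArm.countBefore u (j + 1)) =
            A.closedForm (SingleArm.countBefore u j) (u j)
              (SingleArm.countBefore u (j + 1) (u j)) ∧
          IsLeast (A.stepValues α (SingleArm.countBefore u j))
            (A.closedForm (SingleArm.countBefore u j) (u j)
              (SingleArm.countBefore u (j + 1) (u j))))) := by
  refine ⟨fun j τ hτ => ?_, fun k => hR.monotone_whittleIndex k,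
    A.existsUnique_isSteadyState, fun hps α hα => ⟨?_, fun j => ?_⟩⟩
  · have h := hu.isLeast_indifferent hR j τ hτ
    exact ⟨h, SingleArm.whittleIndex_eq_of_isLeast h⟩
  · intro Γ Γ' hlt hsum hleast v hv
    rwa [A.stepRatio_add_single hps hα hv
      (SingleArm.eq_of_sum_eq_add_one (le_of_lt hlt) hsum hv)] at hleast
  · exact ⟨SingleArm.stepRatio_countBefore hps hα u j, hu.isLeast_stepValues hR hps hα j⟩
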